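/- Let $U\subseteq\mathbb R^2$ be open, with coordinates $x=x^1$, $y=x^2$, and let $P,Q,R,S$ be real $C^\infty$ functions on $U$, regarded as the coefficients of the equation $y''=P+3Q\,y'+3R\,y'^2+S\,y'^3$. Write $f_{p.q}=\partial^{p+q}f/\partial x^p\partial y^q$ and $(d^{ij})=\begin{pmatrix}0&1\\-1&0\end{pmatrix}$. **Sharipov's fields.** Put $$A=P_{0.2}-2Q_{1.1}+R_{2.0}+2PS_{1.0}+SP_{1.0}-3PR_{0.1}-3RP_{0.1}-3QR_{1.0}+6QQ_{0.1},$$ $$B=S_{2.0}-2R_{1.1}+Q_{0.2}-2SP_{0.1}-PS_{0.1}+3SQ_{1.0}+3QS_{1.0}+3RQ_{0.1}-6RR_{1.0},$$ $$G=-BB_{1.0}-3AB_{0.1}+4BA_{0.1}+3SA^2-6RBA+3QB^2,$$ $$H=-AA_{0.1}-3BA_{1.0}+4AB_{1.0}-3PB^2+6QAB-3RA^2,$$ and let $F$ be the real function with $3F^5=AG+BH$. Where $A\ne0$ put $N=-\dfrac{H}{3A}$ and $$\varphi_1=-\frac{3(BP+A_{1.0})}{5A}+\frac35Q,\qquad \varphi_2=\frac{3B(BP+A_{1.0})}{5A^2}-\frac{3(B_{1.0}+A_{0.1}+3BQ)}{5A}+\frac65R,$$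 $$\Omega=\frac56\sum_{i,j}\Bigl(\frac{\partial\varphi_i}{\partial x^j}-\frac{\partial\varphi_j}{\partial x^i}\Bigr)d^{ij},$$ $$M=-\frac{12BN(BP+A_{1.0})}{5A}+BN_{1.0}+\frac{24}5BNQ+\frac65NB_{1.0}+\frac65NA_{0.1}-AN_{0.1}-\frac{12}5ANR,$$ $$\gamma_1=\frac{6N(BP+A_{1.0})}{5A}-N_{1.0}-\frac65NQ-2\Omega A,$$ $$\gamma_2=-\frac{6BN(BP+A_{1.0})}{5A^2}+\frac{18NBQ}{5A}+\frac{6N(B_{1.0}+A_{0.1})}{5A}-N_{0.1}-\frac{12}5NR-2\Omega B.$$ Where $A=0$ and $B\neq0$ put instead $N=\dfrac{G}{3B}$ and $$\varphi_1=-\frac{3A(AS-B_{0.1})}{5B^2}-\frac{3(A_{0.1}+B_{1.0}-3AR)}{5B}-\frac65Q,\qquad \varphi_2=\frac{3(AS-B_{0.1})}{5B}-\frac35R,$$ $$M=-\frac{12AN(AS-B_{0.1})}{5B}-AN_{0.1}+\frac{24}5ANR-\frac65NA_{0.1}-\frac65NB_{1.0}+BN_{1.0}-\frac{12}5BNQ,$$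 $$\gamma_1=\frac{6AN(AS-B_{0.1})}{5B^2}-\frac{18NAR}{5B}+\frac{6N(A_{0.1}+B_{1.0})}{5B}-N_{1.0}+\frac{12}5NQ-2\Omega A,$$ $$\gamma_2=-\frac{6N(AS-B_{0.1})}{5B}-N_{0.1}+\frac65NR-2\Omega B,$$ with $\Omega$ given by the same formula in terms of $\varphi_1,\varphi_2$. (These fields are used only where $F=0$ and $(A,B)\ne(0,0)$.) Let $\boldsymbol\alpha=(\alpha^1,\alpha^2)=(B,-A)$ and $\boldsymbol\gamma=(\gamma^1,\gamma^2)=(\gamma_2,-\gamma_1)$. Let $\theta_{ijk}$ be totally symmetric with $\theta_{111}=P$, $\theta_{112}=Q$, $\theta_{122}=R$, $\theta_{222}=S$, let $\theta^k_{ij}=\sum_r d^{kr}\theta_{rij}$ and $\varGamma^k_{ij}=\theta^k_{ij}-\frac13(\varphi_i\delta^k_j+\varphi_j\delta^k_i)$. For an array $T=(T^{i_1\dots i_r}_{j_1\dots j_s})$ of differentiable functions on $U$ (the components of a pseudotensorial field of type $(r,s)$ and weight $m\in\mathbb Z$) put $$\nabla_kT^{i_1\dots i_r}_{j_1\dots j_s}=\frac{\partial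 T^{i_1\dots i_r}_{j_1\dots j_s}}{\partial x^k}+\sum_{n=1}^r\sum_{v}\varGamma^{i_n}_{kv}T^{i_1\dots v\dots i_r}_{j_1\dots j_s}-\sum_{n=1}^s\sum_{w}\varGamma^{w}_{kj_n}T^{i_1\dots i_r}_{j_1\dots w\dots j_s}+m\,\varphi_k\,T^{i_1\dots i_r}_{j_1\dots j_s},$$ and $\nabla_{\boldsymbol\alpha}=\alpha^1\nabla_1+\alpha^2\nabla_2$, $\nabla_{\boldsymbol\gamma}=\gamma^1\nabla_1+\gamma^2\nabla_2$. The function $\Omega$ is differentiated as a pseudoscalar field (type $(0,0)$) of weight $1$. **Bagderina's quantities.** Put $\alpha_0=Q_{1.0}-P_{0.1}+2PR-2Q^2$, $\alpha_1=R_{1.0}-Q_{0.1}+PS-QR$, $\alpha_2=S_{1.0}-R_{0.1}+2QS-2R^2$, and $$\beta_1=\partial_x\alpha_1-\partial_y\alpha_0+R\alpha_0-2Q\alpha_1+P\alpha_2,\qquad \beta_2=\partial_x\alpha_2-\partial_y\alpha_1+S\alpha_0-2R\alpha_1+Q\alpha_2,$$ $$\gamma_{10}=\partial_x\beta_1-Q\beta_1+P\beta_2,\qquad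 \gamma_{11}=\partial_x\beta_2-R\beta_1+Q\beta_2,$$ $$\gamma_{20}=\partial_y\beta_1-R\beta_1+Q\beta_2,\qquad \gamma_{21}=\partial_y\beta_2-S\beta_1+R\beta_2,$$ $$\Gamma_0=3\beta_2\gamma_{10}+\beta_1(\gamma_{20}-4\gamma_{11}),\qquad J_0=\beta_2^2\gamma_{10}-\beta_1\beta_2(\gamma_{20}+\gamma_{11})+\beta_1^2\gamma_{21},$$ $$\delta_{10}=\partial_x\gamma_{10}-2Q\gamma_{10}+P(\gamma_{20}+\gamma_{11})-5\alpha_0\beta_1,$$ $$\delta_{20}=\partial_x\gamma_{20}-R\gamma_{10}+P\gamma_{21}-4\alpha_1\beta_1-\alpha_0\beta_2,$$ $$\delta_{11}=\partial_x\gamma_{11}-R\gamma_{10}+P\gamma_{21}-\alpha_1\beta_1-4\alpha_0\beta_2,$$ $$\delta_{21}=\partial_x\gamma_{21}-R(\gamma_{20}+\gamma_{11})+2Q\gamma_{21}-5\alpha_1\beta_2,$$ $$\epsilon_{10}=\partial_x\delta_{10}-3Q\delta_{10}+P(2\delta_{20}+\delta_{11})-12\alpha_0\gamma_{10},$$ $$\epsilon_{11}=\partial_x\delta_{11}-R\delta_{10}-Q\delta_{11}+2P\delta_{21}-2\alpha_1\gamma_{10}-10\alpha_0\gamma_{11}-10\beta_1^2.$$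 Where $\beta_1\ne0$ and $\Gamma_0\neq0$ put $$j_0=\frac3{\beta_1}\Bigl(\frac{\beta_2}{\beta_1}\delta_{10}-\delta_{11}\Bigr)+\frac{6\gamma_{10}}{\beta_1^2}\Bigl(\gamma_{11}-\frac{\beta_2}{\beta_1}\gamma_{10}\Bigr),$$ $$e_1=\frac5{\beta_1^2}\Bigl(\frac{\beta_2}{\beta_1}\epsilon_{10}-\epsilon_{11}\Bigr)+\frac{15\,\delta_{10}}{\beta_1^3}\Bigl(\gamma_{11}-\frac{\beta_2}{\beta_1}\gamma_{10}\Bigr)-\frac{6\gamma_{10}}{\beta_1^2}\,j_0,\qquad \mu_1=j_0,\qquad \mu_2=\frac{3\beta_1e_1}{\Gamma_0}.$$ Bagderina's second invariant differentiation operator is $$\mathcal D_2^{\mathrm{Bgd}}=\Bigl(\mu_2\beta_2-\frac{3\mu_1}{\beta_1}\Bigr)\frac{\partial}{\partial x}-\mu_2\beta_1\frac{\partial}{\partial y};$$ it is extended to pseudotensorial fields by replacing $\partial/\partial x$, $\partial/\partial y$ with $\nabla_1,\nabla_2$. **Classes.** The equation belongs to ShrID1 on $U$ if $F=0$, $(A,B)\ne(0,0)$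 and $M\ne0$ at every point of $U$. It belongs to BgdET2 on $U$ if $J_0=0$, $\beta_1\ne0$, $j_0\neq0$ and $\Gamma_0\ne0$ at every point of $U$. **Lemma 6.2.** The equation belongs to $\mathrm{ShrID1}\cap\mathrm{BgdET2}$ on $U$ if and only if $F=0$, $A\ne0$, $M\ne0$, $\Omega\ne0$ and $N\neq0$ at every point of $U$. In this case $$\mathcal D_2^{\mathrm{Bgd}}=\Bigl(\frac{50}{N}-\frac{5\,\nabla_{\boldsymbol\gamma}\Omega}{M\,N}\Bigr)\nabla_{\boldsymbol\alpha}+\frac{5\,\nabla_{\boldsymbol\alpha}\Omega}{M\,N}\,\nabla_{\boldsymbol\gamma}$$ on $U$, both as an identity of operators on differentiable scalar functions and, for the extended operator, on differentiable pseudotensorial fields of every type $(r,s)$ and every weight $m$. -/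

import Mathlib

open scoped ContDiff

noncomputable section

namespace CubicODE

/-- The coordinate plane with coordinates `(x, y)`. Tensor indices are in `Fin 2`: the index `0`
stands for `x = x¹` and the index `1` stands for `y = x²`. -/
abbrev Plane : Type := ℝ × ℝ

/-- The partial derivative `∂f/∂x`. -/
def dx (f : Plane → ℝ) (p : Plane) : ℝ := fderiv ℝ f p (1, 0)

/-- The partial derivative `∂f/∂y`. -/
def dy (f : Plane → ℝ) (p : Plane) : ℝ := fderiv ℝ f p (0, 1)

/-- The partial derivative `∂f/∂xᵏ`. -/
def pd (k : Fin 2) (f : Plane → ℝ) : Plane → ℝ := ![dx f, dy f] k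

/-- The coefficients of an equation `y'' = P(x,y) + 3 Q(x,y) y' + 3 R(x,y) y'² + S(x,y) y'³`. -/
structure Eqn where
  /-- free term -/
  P : Plane → ℝ
  /-- one third of the coefficient of `y'` -/
  Q : Plane → ℝ
  /-- one third of the coefficient of `y'²` -/
  R : Plane → ℝ
  /-- coefficient of `y'³` -/
  S : Plane → ℝ

/-- The constant skew-symmetric matrix `d^{ij}` that is used to raise indices. -/
def dUp : Matrix (Fin 2) (Fin 2) ℝ := !![0, 1; -1, 0]

/-- Raising an index: `v^i = ∑ₖ d^{ik} vₖ`. -/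
def raise (v : Fin 2 → Plane → ℝ) (i : Fin 2) (p : Plane) : ℝ := ∑ k, dUp i k * v k p

/-- The real fifth root, defined for all real numbers. -/
def fifthRoot (t : ℝ) : ℝ := SignType.sign t * |t| ^ ((1 : ℝ) / 5)

theorem fifthRoot_pow (t : ℝ) : fifthRoot t ^ 5 = t := by
  have h : (|t| ^ ((1 : ℝ) / 5)) ^ 5 = |t| := by
    rw [← Real.rpow_natCast, ← Real.rpow_mul (abs_nonneg t)]
    norm_num
  rw [fifthRoot, mul_pow, h]
  rcases lt_trichotomy t 0 with h0 | h0 | h0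
  · rw [sign_neg h0, abs_of_neg h0]
    norm_num
  · simp [h0]
  · rw [sign_pos h0, abs_of_pos h0]
    norm_num

namespace Eqn

variable (E : Eqn)

/-- Smoothness of the coefficients on a set. -/
def SmoothOn (U : Set Plane) : Prop :=
  ContDiffOn ℝ ∞ E.P U ∧ ContDiffOn ℝ ∞ E.Q U ∧ ContDiffOn ℝ ∞ E.R U ∧ ContDiffOn ℝ ∞ E.S U

section Sharipov

/-- The component `α₁ = A` of the pseudocovectorial field `α`. -/
def A : Plane → ℝ := fun p =>
  dy (dy E.P) p - 2 * dx (dy E.Q) p + dx (dx E.R) p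
    + 2 * E.P p * dx E.S p + E.S p * dx E.P p - 3 * E.P p * dy E.R p - 3 * E.R p * dy E.P p
    - 3 * E.Q p * dx E.R p + 6 * E.Q p * dy E.Q p

/-- The component `α₂ = B` of the pseudocovectorial field `α`. -/
def B : Plane → ℝ := fun p =>
  dx (dx E.S) p - 2 * dx (dy E.R) p + dy (dy E.Q) p
    - 2 * E.S p * dy E.P p - E.P p * dy E.S p + 3 * E.S p * dx E.Q p + 3 * E.Q p * dx E.S p
    + 3 * E.R p * dy E.Q p - 6 * E.R p * dx E.R p

/-- The component `β¹ = β₂ = G` of the field `β`. -/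
def G : Plane → ℝ := fun p =>
  - E.B p * dx E.B p - 3 * E.A p * dy E.B p + 4 * E.B p * dy E.A p
    + 3 * E.S p * E.A p ^ 2 - 6 * E.R p * E.B p * E.A p + 3 * E.Q p * E.B p ^ 2

/-- The component `β² = -β₁ = H` of the field `β`. -/
def H : Plane → ℝ := fun p =>
  - E.A p * dy E.A p - 3 * E.B p * dx E.A p + 4 * E.A p * dx E.B p
    - 3 * E.P p * E.B p ^ 2 + 6 * E.Q p * E.A p * E.B p - 3 * E.R p * E.A p ^ 2

/-- The pseudoscalar field `F` of weight `1`, determined by `3 F⁵ = A G + B H`. -/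
def F : Plane → ℝ := fun p => fifthRoot ((E.A p * E.G p + E.B p * E.H p) / 3)

/-- The pseudoscalar field `N` of weight `2`, with `β = 3 N α`; it is used only if `F = 0` and
`(A, B) ≠ 0`, and the two expressions agree where both `A` and `B` are nonzero. The same remark
applies to the definitions by cases below. -/
def N : Plane → ℝ := fun p =>
  open Classical in if E.A p ≠ 0 then - E.H p / (3 * E.A p) else E.G p / (3 * E.B p)

/-- The quantity `φ₁`. -/
def phi1 : Plane → ℝ := fun p =>
  open Classical in
  if E.A p ≠ 0 then
    - 3 * (E.B p * E.P p + dx E.A p) / (5 * E.A p) + 3 / 5 * E.Q p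
  else
    - 3 * E.A p * (E.A p * E.S p - dy E.B p) / (5 * E.B p ^ 2)
      - 3 * (dy E.A p + dx E.B p - 3 * E.A p * E.R p) / (5 * E.B p) - 6 / 5 * E.Q p

/-- The quantity `φ₂`. -/
def phi2 : Plane → ℝ := fun p =>
  open Classical in
  if E.A p ≠ 0 then
    3 * E.B p * (E.B p * E.P p + dx E.A p) / (5 * E.A p ^ 2)
      - 3 * (dx E.B p + dy E.A p + 3 * E.B p * E.Q p) / (5 * E.A p) + 6 / 5 * E.R p
  else
    3 * (E.A p * E.S p - dy E.B p) / (5 * E.B p) - 3 / 5 * E.R p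

/-- The quantities `φᵢ`. -/
def phi (i : Fin 2) : Plane → ℝ := ![E.phi1, E.phi2] i

/-- `ω_{ij} = ∂φᵢ/∂xʲ - ∂φⱼ/∂xⁱ`. -/
def omega (i j : Fin 2) (p : Plane) : ℝ := pd j (E.phi i) p - pd i (E.phi j) p

/-- The pseudoscalar field `Ω = (5/6) ∑ᵢⱼ ω_{ij} d^{ij}` of weight `1`. -/
def Omega : Plane → ℝ := fun p => 5 / 6 * ∑ i, ∑ j, E.omega i j p * dUp i j

/-- The pseudoscalar field `M` of weight `4`. -/
def M : Plane → ℝ := fun p =>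
  open Classical in
  if E.A p ≠ 0 then
    - 12 * E.B p * E.N p * (E.B p * E.P p + dx E.A p) / (5 * E.A p)
      + E.B p * dx E.N p + 24 / 5 * E.B p * E.N p * E.Q p
      + 6 / 5 * E.N p * dx E.B p + 6 / 5 * E.N p * dy E.A p - E.A p * dy E.N p
      - 12 / 5 * E.A p * E.N p * E.R p
  else
    - 12 * E.A p * E.N p * (E.A p * E.S p - dy E.B p) / (5 * E.B p)
      - E.A p * dy E.N p + 24 / 5 * E.A p * E.N p * E.R p
      - 6 / 5 * E.N p * dy E.A p - 6 / 5 * E.N p * dx E.B p + E.B p * dx E.N p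
      - 12 / 5 * E.B p * E.N p * E.Q p

/-- The component `γ₁` of the pseudocovectorial field `γ` of weight `2`. -/
def gamma1 : Plane → ℝ := fun p =>
  open Classical in
  if E.A p ≠ 0 then
    6 * E.N p * (E.B p * E.P p + dx E.A p) / (5 * E.A p)
      - dx E.N p - 6 / 5 * E.N p * E.Q p - 2 * E.Omega p * E.A p
  else
    6 * E.A p * E.N p * (E.A p * E.S p - dy E.B p) / (5 * E.B p ^ 2)
      - 18 * E.N p * E.A p * E.R p / (5 * E.B p)
      + 6 * E.N p * (dy E.A p + dx E.B p) / (5 * E.B p)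
      - dx E.N p + 12 / 5 * E.N p * E.Q p - 2 * E.Omega p * E.A p

/-- The component `γ₂` of the pseudocovectorial field `γ` of weight `2`. -/
def gamma2 : Plane → ℝ := fun p =>
  open Classical in
  if E.A p ≠ 0 then
    - 6 * E.B p * E.N p * (E.B p * E.P p + dx E.A p) / (5 * E.A p ^ 2)
      + 18 * E.N p * E.B p * E.Q p / (5 * E.A p)
      + 6 * E.N p * (dx E.B p + dy E.A p) / (5 * E.A p)
      - dy E.N p - 12 / 5 * E.N p * E.R p - 2 * E.Omega p * E.B p
  else
    - 6 * E.N p * (E.A p * E.S p - dy E.B p) / (5 * E.B p)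
      - dy E.N p + 6 / 5 * E.N p * E.R p - 2 * E.Omega p * E.B p

/-- The pseudovectorial field `α` of weight `2`: `α¹ = B`, `α² = -A`. -/
def alphaUp : Fin 2 → Plane → ℝ := raise ![E.A, E.B]

/-- The pseudovectorial field `γ` of weight `3`: `γ¹ = γ₂`, `γ² = -γ₁`. -/
def gammaUp : Fin 2 → Plane → ℝ := raise ![E.gamma1, E.gamma2]

/-- The totally symmetric array with `θ₁₁₁ = P`, `θ₁₁₂ = Q`, `θ₁₂₂ = R`, `θ₂₂₂ = S`. -/
def thetaLow (i j k : Fin 2) : Plane → ℝ :=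
  match (i : ℕ) + (j : ℕ) + (k : ℕ) with
  | 0 => E.P
  | 1 => E.Q
  | 2 => E.R
  | _ => E.S

/-- The array `θ^k_{ij} = ∑ᵣ d^{kr} θ_{rij}`; these are the coefficients of the trace-free
symmetric connection whose unparametrized geodesics are the integral curves of the equation. -/
def theta (k i j : Fin 2) (p : Plane) : ℝ := ∑ r, dUp k r * E.thetaLow r i j p

/-- The connection components `Γ^k_{ij} = θ^k_{ij} - (φᵢ δ^k_j + φⱼ δ^k_i) / 3`. -/
def conn (k i j : Fin 2) (p : Plane) : ℝ :=
  E.theta k i j p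
    - (E.phi i p * (if k = j then 1 else 0) + E.phi j p * (if k = i then 1 else 0)) / 3

end Sharipov

end Eqn

/-- The components, in the coordinates `(x, y)`, of a pseudotensorial field of type `(r, s)`:
`T i j` is the component with upper multi-index `i` and lower multi-index `j`. -/
abbrev TField (r s : ℕ) : Type := (Fin r → Fin 2) → (Fin s → Fin 2) → Plane → ℝ

/-- A pseudoscalar field as a field of type `(0, 0)`. -/
def scalarField (f : Plane → ℝ) : TField 0 0 := fun _ _ => f

namespace Eqn

variable (E : Eqn)

/-- The covariant derivative `∇ₖ T` of a pseudotensorial field `T` of type `(r, s)` and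
weight `m`. -/
def nabla {r s : ℕ} (m : ℤ) (k : Fin 2) (T : TField r s) : TField r s := fun i j p =>
  pd k (T i j) p
    + ∑ n, ∑ v, E.conn (i n) k v p * T (Function.update i n v) j p
    - ∑ n, ∑ w, E.conn w k (j n) p * T i (Function.update j n w) p
    + (m : ℝ) * E.phi k p * T i j p

/-- The covariant differentiation `∇_X = X¹ ∇₁ + X² ∇₂` along `X`, applied to a pseudotensorial
field of type `(r, s)` and weight `m`. -/
def nablaAlong (X : Fin 2 → Plane → ℝ) {r s : ℕ} (m : ℤ) (T : TField r s) : TField r s :=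
  fun i j p => X 0 p * E.nabla m 0 T i j p + X 1 p * E.nabla m 1 T i j p

/-- `∇_X Ω`, where `Ω` is a pseudoscalar field of weight `1`. -/
def nablaOmega (X : Fin 2 → Plane → ℝ) (p : Plane) : ℝ :=
  E.nablaAlong X 1 (scalarField E.Omega) Fin.elim0 Fin.elim0 p

section Bagderina

/-- Bagderina's quantity `α₀`. -/
def bAlpha0 : Plane → ℝ := fun p =>
  dx E.Q p - dy E.P p + 2 * E.P p * E.R p - 2 * E.Q p ^ 2

/-- Bagderina's quantity `α₁`. -/
def bAlpha1 : Plane → ℝ := fun p =>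
  dx E.R p - dy E.Q p + E.P p * E.S p - E.Q p * E.R p

/-- Bagderina's quantity `α₂`. -/
def bAlpha2 : Plane → ℝ := fun p =>
  dx E.S p - dy E.R p + 2 * E.Q p * E.S p - 2 * E.R p ^ 2

/-- Bagderina's quantity `β₁`. -/
def bBeta1 : Plane → ℝ := fun p =>
  dx E.bAlpha1 p - dy E.bAlpha0 p + E.R p * E.bAlpha0 p - 2 * E.Q p * E.bAlpha1 p
    + E.P p * E.bAlpha2 p

/-- Bagderina's quantity `β₂`. -/
def bBeta2 : Plane → ℝ := fun p =>
  dx E.bAlpha2 p - dy E.bAlpha1 p + E.S p * E.bAlpha0 p - 2 * E.R p * E.bAlpha1 p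
    + E.Q p * E.bAlpha2 p

/-- Bagderina's quantity `γ₁₀`. -/
def bGamma10 : Plane → ℝ := fun p =>
  dx E.bBeta1 p - E.Q p * E.bBeta1 p + E.P p * E.bBeta2 p

/-- Bagderina's quantity `γ₁₁`. -/
def bGamma11 : Plane → ℝ := fun p =>
  dx E.bBeta2 p - E.R p * E.bBeta1 p + E.Q p * E.bBeta2 p

/-- Bagderina's quantity `γ₂₀`. -/
def bGamma20 : Plane → ℝ := fun p =>
  dy E.bBeta1 p - E.R p * E.bBeta1 p + E.Q p * E.bBeta2 p

/-- Bagderina's quantity `γ₂₁`. -/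
def bGamma21 : Plane → ℝ := fun p =>
  dy E.bBeta2 p - E.S p * E.bBeta1 p + E.R p * E.bBeta2 p

/-- Bagderina's quantity `Γ₀`. -/
def bGamma0 : Plane → ℝ := fun p =>
  3 * E.bBeta2 p * E.bGamma10 p + E.bBeta1 p * (E.bGamma20 p - 4 * E.bGamma11 p)

/-- Bagderina's quantity `J₀`. -/
def bJ0 : Plane → ℝ := fun p =>
  E.bBeta2 p ^ 2 * E.bGamma10 p - E.bBeta1 p * E.bBeta2 p * (E.bGamma20 p + E.bGamma11 p)
    + E.bBeta1 p ^ 2 * E.bGamma21 p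

/-- Bagderina's quantity `δ₁₀`. -/
def bDelta10 : Plane → ℝ := fun p =>
  dx E.bGamma10 p - 2 * E.Q p * E.bGamma10 p + E.P p * (E.bGamma20 p + E.bGamma11 p)
    - 5 * E.bAlpha0 p * E.bBeta1 p

/-- Bagderina's quantity `δ₂₀`. -/
def bDelta20 : Plane → ℝ := fun p =>
  dx E.bGamma20 p - E.R p * E.bGamma10 p + E.P p * E.bGamma21 p
    - 4 * E.bAlpha1 p * E.bBeta1 p - E.bAlpha0 p * E.bBeta2 p

/-- Bagderina's quantity `δ₁₁`. -/
def bDelta11 : Plane → ℝ := fun p =>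
  dx E.bGamma11 p - E.R p * E.bGamma10 p + E.P p * E.bGamma21 p
    - E.bAlpha1 p * E.bBeta1 p - 4 * E.bAlpha0 p * E.bBeta2 p

/-- Bagderina's quantity `δ₂₁`. -/
def bDelta21 : Plane → ℝ := fun p =>
  dx E.bGamma21 p - E.R p * (E.bGamma20 p + E.bGamma11 p) + 2 * E.Q p * E.bGamma21 p
    - 5 * E.bAlpha1 p * E.bBeta2 p

/-- Bagderina's quantity `ε₁₀`. -/
def bEpsilon10 : Plane → ℝ := fun p =>
  dx E.bDelta10 p - 3 * E.Q p * E.bDelta10 p + E.P p * (2 * E.bDelta20 p + E.bDelta11 p)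
    - 12 * E.bAlpha0 p * E.bGamma10 p

/-- Bagderina's quantity `ε₁₁`. -/
def bEpsilon11 : Plane → ℝ := fun p =>
  dx E.bDelta11 p - E.R p * E.bDelta10 p - E.Q p * E.bDelta11 p + 2 * E.P p * E.bDelta21 p
    - 2 * E.bAlpha1 p * E.bGamma10 p - 10 * E.bAlpha0 p * E.bGamma11 p - 10 * E.bBeta1 p ^ 2

/-- Bagderina's quantity `j₀`. -/
def bj0 : Plane → ℝ := fun p =>
  3 / E.bBeta1 p * (E.bBeta2 p / E.bBeta1 p * E.bDelta10 p - E.bDelta11 p)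
    + 6 * E.bGamma10 p / E.bBeta1 p ^ 2
      * (E.bGamma11 p - E.bBeta2 p / E.bBeta1 p * E.bGamma10 p)

/-- Bagderina's quantity `e₁`. -/
def be1 : Plane → ℝ := fun p =>
  5 / E.bBeta1 p ^ 2 * (E.bBeta2 p / E.bBeta1 p * E.bEpsilon10 p - E.bEpsilon11 p)
    + 15 * E.bDelta10 p / E.bBeta1 p ^ 3
      * (E.bGamma11 p - E.bBeta2 p / E.bBeta1 p * E.bGamma10 p)
    - 6 * E.bGamma10 p / E.bBeta1 p ^ 2 * E.bj0 p

/-- Bagderina's quantity `μ₁`, which is `j₀` for her equations of type two. -/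
def bMu1 : Plane → ℝ := E.bj0

/-- Bagderina's quantity `μ₂` for her equations of type two. -/
def bMu2 : Plane → ℝ := fun p => 3 * E.bBeta1 p * E.be1 p / E.bGamma0 p

/-- The coefficients of Bagderina's second invariant differentiation operator
`D₂ = (μ₂ β₂ - 3 μ₁ / β₁) ∂/∂x - μ₂ β₁ ∂/∂y`. -/
def bD2Coeff : Fin 2 → Plane → ℝ :=
  ![fun p => E.bMu2 p * E.bBeta2 p - 3 * E.bMu1 p / E.bBeta1 p,
    fun p => - E.bMu2 p * E.bBeta1 p]

/-- Bagderina's second invariant differentiation operator on scalar functions. -/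
def bD2 (f : Plane → ℝ) (p : Plane) : ℝ :=
  E.bD2Coeff 0 p * dx f p + E.bD2Coeff 1 p * dy f p

/-- Bagderina's second invariant differentiation operator, extended to pseudotensorial fields of
type `(r, s)` and weight `m` by replacing partial derivatives with covariant ones. -/
def bD2Ext {r s : ℕ} (m : ℤ) (T : TField r s) : TField r s := fun i j p =>
  E.bD2Coeff 0 p * E.nabla m 0 T i j p + E.bD2Coeff 1 p * E.nabla m 1 T i j p

end Bagderina

/-- The first case of intermediate degeneration: `F = 0`, `α ≠ 0`, `M ≠ 0` at each point. -/
def ShrID1 (U : Set Plane) : Prop :=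
  ∀ p ∈ U, E.F p = 0 ∧ (E.A p ≠ 0 ∨ E.B p ≠ 0) ∧ E.M p ≠ 0

/-- Bagderina's equations of type two: `J₀ = 0`, `β₁ ≠ 0`, `j₀ ≠ 0`, `Γ₀ ≠ 0` at each point. -/
def BgdET2 (U : Set Plane) : Prop :=
  ∀ p ∈ U, E.bJ0 p = 0 ∧ E.bBeta1 p ≠ 0 ∧ E.bj0 p ≠ 0 ∧ E.bGamma0 p ≠ 0

end Eqn

end CubicODE

end

/-! Write α = (A, B). Expanding definitions gives A = β₁, B = β₂, H = -Γ₀ and AG + BH = -3J₀. Hence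
F = 0 is the condition J₀ = 0, and N = Γ₀/(3β₁) where β₁ ≠ 0.

Assume J₀ = 0 and β₁ ≠ 0, and put λ = β₂/β₁ (`slope`). Then J₀ = 0 is a first-order equation for λ,
which expresses λ_y through λ and u = `slopeDx`. Equality of mixed partials of λ gives u_y, and that
of u gives Ω_y in terms of Ω_x; the curvature terms left over form β₂ - λβ₁ = 0. Substituting β₂ =
λβ₁ into Bagderina's tower shows that γ₁₁, δ₁₁, ε₁₁ are λ times γ₁₀, δ₁₀, ε₁₀ plus terms in u, Ω and
Ω_x. The combinations j₀ and e₁ remove the multiples of λ and all u-terms: j₀ = -3Ω (`bj0_eq_Omega`)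
and e₁ = 50 - 5∇₁Ω/A (`be1_eq_Omega`). The class conditions then match, and μ₂ = e₁/N.

So D₂ = (e₁/N)∇_α + (9Ω/A)∇₁. Since M = Aγ₂ - Bγ₁, the fields α and γ form a frame when M ≠ 0, with
M∇₁ = A∇_γ - γ₁∇_α. The relation ∇_αΩ = (9/5)NΩ (`nabla_alpha_Omega`) turns 9Ω into 5∇_αΩ/N, and
expanding D₂ in the frame gives the formula (`bD2Coeff_eq`). -/

noncomputable section

set_option linter.unusedSimpArgs false

namespace CubicODE

/-! ### Differentiation rules for `dx` and `dy`. -/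

section Calculus

variable {f g : Plane → ℝ} {U : Set Plane} {p : Plane}

theorem dx_add (hf : DifferentiableAt ℝ f p) (hg : DifferentiableAt ℝ g p) :
    dx (fun q => f q + g q) p = dx f p + dx g p := by
  simp [dx, fderiv_fun_add hf hg]

theorem dy_add (hf : DifferentiableAt ℝ f p) (hg : DifferentiableAt ℝ g p) :
    dy (fun q => f q + g q) p = dy f p + dy g p := by
  simp [dy, fderiv_fun_add hf hg]

theorem dx_sub (hf : DifferentiableAt ℝ f p) (hg : DifferentiableAt ℝ g p) :
    dx (fun q => f q - g q) p = dx f p - dx g p := by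
  simp [dx, fderiv_fun_sub hf hg]

theorem dy_sub (hf : DifferentiableAt ℝ f p) (hg : DifferentiableAt ℝ g p) :
    dy (fun q => f q - g q) p = dy f p - dy g p := by
  simp [dy, fderiv_fun_sub hf hg]

theorem dx_mul (hf : DifferentiableAt ℝ f p) (hg : DifferentiableAt ℝ g p) :
    dx (fun q => f q * g q) p = dx f p * g p + f p * dx g p := by
  simp [dx, fderiv_fun_mul hf hg]
  ring

theorem dy_mul (hf : DifferentiableAt ℝ f p) (hg : DifferentiableAt ℝ g p) :
    dy (fun q => f q * g q) p = dy f p * g p + f p * dy g p := by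
  simp [dy, fderiv_fun_mul hf hg]
  ring

theorem dx_const (c : ℝ) : dx (fun _ => c) p = 0 := by
  simp [dx]

theorem dy_const (c : ℝ) : dy (fun _ => c) p = 0 := by
  simp [dy]

theorem dx_pow (hf : DifferentiableAt ℝ f p) :
    dx (fun q => f q ^ 2) p = 2 * f p * dx f p := by
  simp only [pow_two]
  rw [dx_mul hf hf]
  ring

theorem dy_pow (hf : DifferentiableAt ℝ f p) :
    dy (fun q => f q ^ 2) p = 2 * f p * dy f p := by
  simp only [pow_two]
  rw [dy_mul hf hf]
  ring

theorem dx_congr (hU : IsOpen U) (h : ∀ q ∈ U, f q = g q) (hp : p ∈ U) : dx f p = dx g p := by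
  rw [dx, dx, Filter.EventuallyEq.fderiv_eq (Filter.eventuallyEq_of_mem (hU.mem_nhds hp) h)]

theorem dy_congr (hU : IsOpen U) (h : ∀ q ∈ U, f q = g q) (hp : p ∈ U) : dy f p = dy g p := by
  rw [dy, dy, Filter.EventuallyEq.fderiv_eq (Filter.eventuallyEq_of_mem (hU.mem_nhds hp) h)]

/-- The product rule applied to (f/g)·g, which equals f near `p`, is solved for the derivative of
the quotient. -/
theorem dx_div (hf : DifferentiableAt ℝ f p) (hg : DifferentiableAt ℝ g p) (h0 : g p ≠ 0) :
    dx (fun q => f q / g q) p = (dx f p * g p - f p * dx g p) / g p ^ 2 := by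
  have hd : DifferentiableAt ℝ (fun q => f q / g q) p := by
    simpa only [div_eq_mul_inv] using hf.fun_mul (hg.fun_inv h0)
  have hm := dx_mul hd hg
  have he : dx (fun q => f q / g q * g q) p = dx f p := by
    rw [dx, dx, Filter.EventuallyEq.fderiv_eq]
    filter_upwards [hg.continuousAt.eventually_ne h0] with q hq
    exact div_mul_cancel₀ _ hq
  rw [he] at hm
  rw [hm]
  field_simp
  ring

theorem dy_div (hf : DifferentiableAt ℝ f p) (hg : DifferentiableAt ℝ g p) (h0 : g p ≠ 0) :
    dy (fun q => f q / g q) p = (dy f p * g p - f p * dy g p) / g p ^ 2 := by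
  have hd : DifferentiableAt ℝ (fun q => f q / g q) p := by
    simpa only [div_eq_mul_inv] using hf.fun_mul (hg.fun_inv h0)
  have hm := dy_mul hd hg
  have he : dy (fun q => f q / g q * g q) p = dy f p := by
    rw [dy, dy, Filter.EventuallyEq.fderiv_eq]
    filter_upwards [hg.continuousAt.eventually_ne h0] with q hq
    exact div_mul_cancel₀ _ hq
  rw [he] at hm
  rw [hm]
  field_simp
  ring

theorem contDiffOn_dx (hU : IsOpen U) (hf : ContDiffOn ℝ ∞ f U) : ContDiffOn ℝ ∞ (dx f) U :=
  (hf.fderiv_of_isOpen hU (by simp)).clm_apply contDiffOn_const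

theorem contDiffOn_dy (hU : IsOpen U) (hf : ContDiffOn ℝ ∞ f U) : ContDiffOn ℝ ∞ (dy f) U :=
  (hf.fderiv_of_isOpen hU (by simp)).clm_apply contDiffOn_const

theorem _root_.ContDiffOn.differentiableAt_of_isOpen (hU : IsOpen U) (hf : ContDiffOn ℝ ∞ f U)
    (hp : p ∈ U) : DifferentiableAt ℝ f p :=
  (hf.contDiffAt (hU.mem_nhds hp)).differentiableAt (by simp)

theorem dx_dy_comm (hU : IsOpen U) (hf : ContDiffOn ℝ ∞ f U) (hp : p ∈ U) :
    dx (dy f) p = dy (dx f) p := by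
  have hc : ContDiffAt ℝ ∞ f p := hf.contDiffAt (hU.mem_nhds hp)
  have hd : DifferentiableAt ℝ (fderiv ℝ f) p :=
    (hc.fderiv_right (m := 1) (by norm_cast)).differentiableAt (by simp)
  have hs : IsSymmSndFDerivAt ℝ f p := hc.isSymmSndFDerivAt (by
    rw [minSmoothness_of_isRCLikeNormedField]
    exact WithTop.coe_le_coe.2 le_top)
  have key : ∀ v w : Plane, fderiv ℝ (fun q => fderiv ℝ f q v) p w
      = fderiv ℝ (fderiv ℝ f) p w v := by
    intro v w
    rw [fderiv_clm_apply hd (differentiableAt_const v)]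
    simp
  change fderiv ℝ (fun q => fderiv ℝ f q (0, 1)) p (1, 0)
    = fderiv ℝ (fun q => fderiv ℝ f q (1, 0)) p (0, 1)
  rw [key, key, hs]

end Calculus

namespace Eqn

variable {E : Eqn} {U : Set Plane} {p : Plane}

/-! ### Smoothness of the quantities αᵢ and βᵢ. -/

section Smoothness

theorem SmoothOn.bAlpha0 (hU : IsOpen U) (hE : E.SmoothOn U) : ContDiffOn ℝ ∞ E.bAlpha0 U := by
  obtain ⟨hP, hQ, hR, hS⟩ := hE
  have hQx := contDiffOn_dx hU hQ
  have hPy := contDiffOn_dy hU hP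
  unfold Eqn.bAlpha0
  fun_prop

theorem SmoothOn.bAlpha1 (hU : IsOpen U) (hE : E.SmoothOn U) : ContDiffOn ℝ ∞ E.bAlpha1 U := by
  obtain ⟨hP, hQ, hR, hS⟩ := hE
  have hRx := contDiffOn_dx hU hR
  have hQy := contDiffOn_dy hU hQ
  unfold Eqn.bAlpha1
  fun_prop

theorem SmoothOn.bAlpha2 (hU : IsOpen U) (hE : E.SmoothOn U) : ContDiffOn ℝ ∞ E.bAlpha2 U := by
  obtain ⟨hP, hQ, hR, hS⟩ := hE
  have hSx := contDiffOn_dx hU hS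
  have hRy := contDiffOn_dy hU hR
  unfold Eqn.bAlpha2
  fun_prop

theorem SmoothOn.bBeta1 (hU : IsOpen U) (hE : E.SmoothOn U) : ContDiffOn ℝ ∞ E.bBeta1 U := by
  have h0 := hE.bAlpha0 hU
  have h1 := hE.bAlpha1 hU
  have h2 := hE.bAlpha2 hU
  have h0y := contDiffOn_dy hU h0
  have h1x := contDiffOn_dx hU h1
  obtain ⟨hP, hQ, hR, hS⟩ := hE
  unfold Eqn.bBeta1
  fun_prop

theorem SmoothOn.bBeta2 (hU : IsOpen U) (hE : E.SmoothOn U) : ContDiffOn ℝ ∞ E.bBeta2 U := by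
  have h0 := hE.bAlpha0 hU
  have h1 := hE.bAlpha1 hU
  have h2 := hE.bAlpha2 hU
  have h1y := contDiffOn_dy hU h1
  have h2x := contDiffOn_dx hU h2
  obtain ⟨hP, hQ, hR, hS⟩ := hE
  unfold Eqn.bBeta2
  fun_prop

end Smoothness

/-- In β₁ the terms cubic in P, Q, R, S cancel. The rest agrees with A up to the order of one mixed
derivative of Q. -/
theorem A_eq_bBeta1 (hU : IsOpen U) (hE : E.SmoothOn U) (hp : p ∈ U) : E.A p = E.bBeta1 p := by
  obtain ⟨hP, hQ, hR, hS⟩ := hE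
  have hPd := hP.differentiableAt_of_isOpen hU hp
  have hQd := hQ.differentiableAt_of_isOpen hU hp
  have hRd := hR.differentiableAt_of_isOpen hU hp
  have hSd := hS.differentiableAt_of_isOpen hU hp
  have hRx := (contDiffOn_dx hU hR).differentiableAt_of_isOpen hU hp
  have hQx := (contDiffOn_dx hU hQ).differentiableAt_of_isOpen hU hp
  have hPy := (contDiffOn_dy hU hP).differentiableAt_of_isOpen hU hp
  have hQy := (contDiffOn_dy hU hQ).differentiableAt_of_isOpen hU hp
  have h1 : dx E.bAlpha1 p = dx (dx E.R) p - dx (dy E.Q) p + (dx E.P p * E.S p + E.P p * dx E.S p)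
      - (dx E.Q p * E.R p + E.Q p * dx E.R p) := by
    unfold bAlpha1
    simp (disch := fun_prop) only [dx_sub, dx_add, dx_mul, dx_pow, dx_const]
  have h0 : dy E.bAlpha0 p = dy (dx E.Q) p - dy (dy E.P) p
      + (2 * dy E.P p * E.R p + 2 * E.P p * dy E.R p)
      - 2 * (2 * E.Q p * dy E.Q p) := by
    unfold bAlpha0
    simp (disch := fun_prop) only [dy_sub, dy_add, dy_mul, dy_pow, dy_const]
    ring
  have hc := dx_dy_comm hU hQ hp
  unfold A bBeta1
  rw [h1, h0]
  unfold bAlpha0 bAlpha1 bAlpha2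
  linear_combination -hc

theorem B_eq_bBeta2 (hU : IsOpen U) (hE : E.SmoothOn U) (hp : p ∈ U) : E.B p = E.bBeta2 p := by
  obtain ⟨hP, hQ, hR, hS⟩ := hE
  have hPd := hP.differentiableAt_of_isOpen hU hp
  have hQd := hQ.differentiableAt_of_isOpen hU hp
  have hRd := hR.differentiableAt_of_isOpen hU hp
  have hSd := hS.differentiableAt_of_isOpen hU hp
  have hSx := (contDiffOn_dx hU hS).differentiableAt_of_isOpen hU hp
  have hRx := (contDiffOn_dx hU hR).differentiableAt_of_isOpen hU hp
  have hRy := (contDiffOn_dy hU hR).differentiableAt_of_isOpen hU hp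
  have hQy := (contDiffOn_dy hU hQ).differentiableAt_of_isOpen hU hp
  have h2 : dx E.bAlpha2 p = dx (dx E.S) p - dx (dy E.R) p
      + (2 * dx E.Q p * E.S p + 2 * E.Q p * dx E.S p) - 2 * (2 * E.R p * dx E.R p) := by
    unfold bAlpha2
    simp (disch := fun_prop) only [dx_sub, dx_add, dx_mul, dx_pow, dx_const]
    ring
  have h1 : dy E.bAlpha1 p = dy (dx E.R) p - dy (dy E.Q) p + (dy E.P p * E.S p + E.P p * dy E.S p)
      - (dy E.Q p * E.R p + E.Q p * dy E.R p) := by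
    unfold bAlpha1
    simp (disch := fun_prop) only [dy_sub, dy_add, dy_mul, dy_pow, dy_const]
  have hc := dx_dy_comm hU hR hp
  unfold B bBeta2
  rw [h1, h2]
  unfold bAlpha0 bAlpha1 bAlpha2
  linear_combination -hc

/-- The ratio `λ = B / A`, the slope of the direction annihilated by `α`. -/
def slope (E : Eqn) : Plane → ℝ := fun q => E.bBeta2 q / E.bBeta1 q

/-- The `x`-component of the covariant derivative of the slope `λ`. -/
def slopeDx (E : Eqn) : Plane → ℝ := fun q =>
  dx E.slope q - E.P q * E.slope q ^ 2 + 2 * E.Q q * E.slope q - E.R q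

/-- Explicit form, in terms of the slope, that `Ω` takes where `F = 0`. -/
def slopeOmega (E : Eqn) : Plane → ℝ := fun q =>
  dx E.slopeDx q + (E.Q q - E.P q * E.slope q) * E.slopeDx q - E.bAlpha1 q
    + E.slope q * E.bAlpha0 q

/-- A smooth equation on an open set `U` with `J₀ = 0` and `β₁ ≠ 0`. -/
structure DegenerateOn (E : Eqn) (U : Set Plane) : Prop where
  isOpen : IsOpen U
  smooth : E.SmoothOn U
  bJ0_eq : ∀ q ∈ U, E.bJ0 q = 0
  bBeta1_ne : ∀ q ∈ U, E.bBeta1 q ≠ 0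

/-! ### Bagderina's tower expressed through the slope λ, when J₀ = 0 and β₁ ≠ 0. -/

namespace DegenerateOn

section Smoothness

theorem contDiffOn_slope (h : E.DegenerateOn U) : ContDiffOn ℝ ∞ E.slope U :=
  (h.smooth.bBeta2 h.isOpen).div (h.smooth.bBeta1 h.isOpen) h.bBeta1_ne

theorem contDiffOn_slopeDx (h : E.DegenerateOn U) : ContDiffOn ℝ ∞ E.slopeDx U := by
  have hl := h.contDiffOn_slope
  have hlx := contDiffOn_dx h.isOpen hl
  obtain ⟨hP, hQ, hR, hS⟩ := h.smooth
  unfold slopeDx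
  fun_prop

theorem contDiffOn_slopeOmega (h : E.DegenerateOn U) : ContDiffOn ℝ ∞ E.slopeOmega U := by
  have hl := h.contDiffOn_slope
  have hu := h.contDiffOn_slopeDx
  have hux := contDiffOn_dx h.isOpen hu
  have h0 := h.smooth.bAlpha0 h.isOpen
  have h1 := h.smooth.bAlpha1 h.isOpen
  obtain ⟨hP, hQ, hR, hS⟩ := h.smooth
  unfold slopeOmega
  fun_prop

theorem contDiffOn_bGamma10 (h : E.DegenerateOn U) : ContDiffOn ℝ ∞ E.bGamma10 U := by
  have h1 := h.smooth.bBeta1 h.isOpen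
  have h2 := h.smooth.bBeta2 h.isOpen
  have h1x := contDiffOn_dx h.isOpen h1
  obtain ⟨hP, hQ, hR, hS⟩ := h.smooth
  unfold bGamma10
  fun_prop

theorem contDiffOn_bGamma20 (h : E.DegenerateOn U) : ContDiffOn ℝ ∞ E.bGamma20 U := by
  have h1 := h.smooth.bBeta1 h.isOpen
  have h2 := h.smooth.bBeta2 h.isOpen
  have h1y := contDiffOn_dy h.isOpen h1
  obtain ⟨hP, hQ, hR, hS⟩ := h.smooth
  unfold bGamma20
  fun_prop

theorem contDiffOn_bGamma11 (h : E.DegenerateOn U) : ContDiffOn ℝ ∞ E.bGamma11 U := by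
  have h1 := h.smooth.bBeta1 h.isOpen
  have h2 := h.smooth.bBeta2 h.isOpen
  have h2x := contDiffOn_dx h.isOpen h2
  obtain ⟨hP, hQ, hR, hS⟩ := h.smooth
  unfold bGamma11
  fun_prop

theorem contDiffOn_bDelta10 (h : E.DegenerateOn U) : ContDiffOn ℝ ∞ E.bDelta10 U := by
  have h0 := h.smooth.bAlpha0 h.isOpen
  have h1 := h.smooth.bBeta1 h.isOpen
  have g10 := h.contDiffOn_bGamma10
  have g20 := h.contDiffOn_bGamma20
  have g11 := h.contDiffOn_bGamma11
  have g10x := contDiffOn_dx h.isOpen g10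
  obtain ⟨hP, hQ, hR, hS⟩ := h.smooth
  unfold bDelta10
  fun_prop

end Smoothness

theorem bBeta2_eq (h : E.DegenerateOn U) (hp : p ∈ U) :
    E.bBeta2 p = E.slope p * E.bBeta1 p :=
  (div_mul_cancel₀ _ (h.bBeta1_ne p hp)).symm

theorem dx_bBeta2 (h : E.DegenerateOn U) (hp : p ∈ U) :
    dx E.bBeta2 p = dx E.slope p * E.bBeta1 p + E.slope p * dx E.bBeta1 p := by
  rw [dx_congr h.isOpen (fun q hq => h.bBeta2_eq hq) hp, dx_mul
    (h.contDiffOn_slope.differentiableAt_of_isOpen h.isOpen hp)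
    ((h.smooth.bBeta1 h.isOpen).differentiableAt_of_isOpen h.isOpen hp)]

theorem dy_bBeta2 (h : E.DegenerateOn U) (hp : p ∈ U) :
    dy E.bBeta2 p = dy E.slope p * E.bBeta1 p + E.slope p * dy E.bBeta1 p := by
  rw [dy_congr h.isOpen (fun q hq => h.bBeta2_eq hq) hp, dy_mul
    (h.contDiffOn_slope.differentiableAt_of_isOpen h.isOpen hp)
    ((h.smooth.bBeta1 h.isOpen).differentiableAt_of_isOpen h.isOpen hp)]

/-- The condition `J₀ = 0` says that the integral curves of the distribution annihilated by `α`
solve the equation. -/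
theorem dy_slope (h : E.DegenerateOn U) (hp : p ∈ U) :
    dy E.slope p = E.S p - 2 * E.R p * E.slope p + E.Q p * E.slope p ^ 2
      + E.slope p * E.slopeDx p := by
  have hJ := h.bJ0_eq p hp
  unfold bJ0 bGamma10 bGamma20 bGamma11 bGamma21 at hJ
  rw [h.dx_bBeta2 hp, h.dy_bBeta2 hp, h.bBeta2_eq hp] at hJ
  -- With β₂ = λβ₁ the derivatives of β₁ drop out of J₀, which becomes β₁³ times the difference of
  -- the two sides.
  refine mul_left_cancel₀ (pow_ne_zero 3 (h.bBeta1_ne p hp)) ?_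
  unfold slopeDx
  linear_combination hJ

/-- Bottom level of the recursion: the factor λ passes through the operator defining γ₁₁, and the
derivative falling on λ leaves the term β₁u. `bDelta11_eq` and `bEpsilon11_eq` iterate this. -/
theorem bGamma11_eq (h : E.DegenerateOn U) (hp : p ∈ U) :
    E.bGamma11 p = E.slope p * E.bGamma10 p + E.bBeta1 p * E.slopeDx p := by
  unfold bGamma11 bGamma10 slopeDx
  rw [h.dx_bBeta2 hp, h.bBeta2_eq hp]
  ring

/-- Here J₀ = 0 enters, through `dy_slope`. -/
theorem bGamma21_eq (h : E.DegenerateOn U) (hp : p ∈ U) :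
    E.bGamma21 p = E.slope p * E.bGamma20 p + E.slope p * E.bBeta1 p * E.slopeDx p := by
  unfold bGamma21 bGamma20
  rw [h.dy_bBeta2 hp, h.dy_slope hp, h.bBeta2_eq hp]
  ring

theorem dx_bGamma11 (h : E.DegenerateOn U) (hp : p ∈ U) :
    dx E.bGamma11 p = dx E.slope p * E.bGamma10 p + E.slope p * dx E.bGamma10 p
      + dx E.bBeta1 p * E.slopeDx p + E.bBeta1 p * dx E.slopeDx p := by
  have hA := (h.smooth.bBeta1 h.isOpen).differentiableAt_of_isOpen h.isOpen hp
  have hl := h.contDiffOn_slope.differentiableAt_of_isOpen h.isOpen hp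
  have hu := h.contDiffOn_slopeDx.differentiableAt_of_isOpen h.isOpen hp
  have hg := h.contDiffOn_bGamma10.differentiableAt_of_isOpen h.isOpen hp
  rw [dx_congr h.isOpen (fun q hq => h.bGamma11_eq hq) hp]
  simp (disch := fun_prop) only [dx_sub, dx_add, dx_mul, dx_pow, dx_const]
  ring

theorem dx_bGamma21 (h : E.DegenerateOn U) (hp : p ∈ U) :
    dx E.bGamma21 p = dx E.slope p * (E.bGamma20 p + E.bBeta1 p * E.slopeDx p)
      + E.slope p * (dx E.bGamma20 p + dx E.bBeta1 p * E.slopeDx p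
        + E.bBeta1 p * dx E.slopeDx p) := by
  have hA := (h.smooth.bBeta1 h.isOpen).differentiableAt_of_isOpen h.isOpen hp
  have hl := h.contDiffOn_slope.differentiableAt_of_isOpen h.isOpen hp
  have hu := h.contDiffOn_slopeDx.differentiableAt_of_isOpen h.isOpen hp
  have hg := h.contDiffOn_bGamma20.differentiableAt_of_isOpen h.isOpen hp
  rw [dx_congr h.isOpen (fun q hq => h.bGamma21_eq hq) hp]
  simp (disch := fun_prop) only [dx_sub, dx_add, dx_mul, dx_pow, dx_const]
  ring

/-- Like `dx_slope`, `dx_bGamma10` and `dx_slopeDx`, this solves a definition for its raw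
x-derivative. Once these are eliminated, the tower identities are polynomial. -/
theorem dx_bBeta1 (h : E.DegenerateOn U) (hp : p ∈ U) :
    dx E.bBeta1 p = E.bGamma10 p + E.Q p * E.bBeta1 p - E.P p * E.slope p * E.bBeta1 p := by
  unfold bGamma10
  rw [h.bBeta2_eq hp]
  ring

theorem dx_slope : dx E.slope p
    = E.slopeDx p + E.P p * E.slope p ^ 2 - 2 * E.Q p * E.slope p + E.R p := by
  unfold slopeDx
  ring

/-- The derivative of u, with the connection and αᵢ terms that accompany it, assembles into
`slopeOmega`. -/
theorem bDelta11_eq (h : E.DegenerateOn U) (hp : p ∈ U) :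
    E.bDelta11 p = E.slope p * E.bDelta10 p + 2 * E.slopeDx p * E.bGamma10 p
      + E.bBeta1 p * E.slopeOmega p := by
  unfold bDelta11 bDelta10 slopeOmega
  rw [h.dx_bGamma11 hp, h.bGamma11_eq hp, h.bGamma21_eq hp, h.bBeta2_eq hp, h.dx_bBeta1 hp,
    dx_slope]
  ring

theorem bDelta21_eq (h : E.DegenerateOn U) (hp : p ∈ U) :
    E.bDelta21 p = E.slope p * E.bDelta20 p
      + E.slopeDx p * (E.bGamma20 p + E.bBeta1 p * E.slopeDx p)
      + E.slope p * (E.slopeDx p * E.bGamma10 p + E.bBeta1 p * E.slopeOmega p) := by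
  unfold bDelta21 bDelta20 slopeOmega
  rw [h.dx_bGamma21 hp, h.bGamma11_eq hp, h.bGamma21_eq hp, h.bBeta2_eq hp, h.dx_bBeta1 hp,
    dx_slope]
  ring

theorem dx_bGamma10 (h : E.DegenerateOn U) (hp : p ∈ U) :
    dx E.bGamma10 p = E.bDelta10 p + 2 * E.Q p * E.bGamma10 p
      - E.P p * (E.bGamma20 p + E.slope p * E.bGamma10 p + E.bBeta1 p * E.slopeDx p)
      + 5 * E.bAlpha0 p * E.bBeta1 p := by
  unfold bDelta10
  rw [h.bGamma11_eq hp]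
  ring

theorem dx_bDelta11 (h : E.DegenerateOn U) (hp : p ∈ U) :
    dx E.bDelta11 p = dx E.slope p * E.bDelta10 p + E.slope p * dx E.bDelta10 p
      + 2 * dx E.slopeDx p * E.bGamma10 p + 2 * E.slopeDx p * dx E.bGamma10 p
      + dx E.bBeta1 p * E.slopeOmega p + E.bBeta1 p * dx E.slopeOmega p := by
  have hA := (h.smooth.bBeta1 h.isOpen).differentiableAt_of_isOpen h.isOpen hp
  have hl := h.contDiffOn_slope.differentiableAt_of_isOpen h.isOpen hp
  have hu := h.contDiffOn_slopeDx.differentiableAt_of_isOpen h.isOpen hp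
  have hg := h.contDiffOn_bGamma10.differentiableAt_of_isOpen h.isOpen hp
  have hd := h.contDiffOn_bDelta10.differentiableAt_of_isOpen h.isOpen hp
  have ho := h.contDiffOn_slopeOmega.differentiableAt_of_isOpen h.isOpen hp
  rw [dx_congr h.isOpen (fun q hq => h.bDelta11_eq hq) hp]
  simp (disch := fun_prop) only [dx_sub, dx_add, dx_mul, dx_pow, dx_const]
  ring

theorem dx_slopeDx : dx E.slopeDx p = E.slopeOmega p
    - (E.Q p - E.P p * E.slope p) * E.slopeDx p + E.bAlpha1 p - E.slope p * E.bAlpha0 p := by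
  unfold slopeOmega
  ring

/-- The term -10β₁² in the definition of ε₁₁ survives unchanged; it is the source of the constant 50
in e₁. -/
theorem bEpsilon11_eq (h : E.DegenerateOn U) (hp : p ∈ U) :
    E.bEpsilon11 p = E.slope p * E.bEpsilon10 p + 3 * E.slopeDx p * E.bDelta10 p
      + 3 * E.bGamma10 p * E.slopeOmega p + E.bBeta1 p * dx E.slopeOmega p
      - 10 * E.bBeta1 p ^ 2 := by
  unfold bEpsilon11 bEpsilon10
  rw [h.dx_bDelta11 hp, h.bDelta11_eq hp, h.bDelta21_eq hp, h.dx_bGamma10 hp, h.bGamma11_eq hp,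
    h.dx_bBeta1 hp, dx_slopeDx, dx_slope]
  ring

/-- The second summand of j₀ cancels the term 2uγ₁₀ of δ₁₁. -/
theorem bj0_eq (h : E.DegenerateOn U) (hp : p ∈ U) : E.bj0 p = -3 * E.slopeOmega p := by
  have hA := h.bBeta1_ne p hp
  unfold bj0
  rw [h.bDelta11_eq hp, h.bGamma11_eq hp, h.bBeta2_eq hp]
  field_simp
  ring

theorem be1_eq (h : E.DegenerateOn U) (hp : p ∈ U) :
    E.be1 p = 50 - 5 * dx E.slopeOmega p / E.bBeta1 p
      + 3 * E.bGamma10 p * E.slopeOmega p / E.bBeta1 p ^ 2 := by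
  have hA := h.bBeta1_ne p hp
  unfold be1
  rw [h.bj0_eq hp, h.bEpsilon11_eq hp, h.bGamma11_eq hp, h.bBeta2_eq hp]
  field_simp
  ring

/-! ### Integrability conditions: the y-derivatives of u and Ω. -/

theorem dy_slopeDx (h : E.DegenerateOn U) (hp : p ∈ U) :
    dy E.slopeDx p = E.slope p * E.slopeOmega p + E.slopeDx p ^ 2
      + E.slopeDx p * (E.Q p * E.slope p - E.R p) + E.bAlpha2 p - E.slope p * E.bAlpha1 p := by
  obtain ⟨hP, hQ, hR, hS⟩ := h.smooth
  have hPd := hP.differentiableAt_of_isOpen h.isOpen hp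
  have hQd := hQ.differentiableAt_of_isOpen h.isOpen hp
  have hRd := hR.differentiableAt_of_isOpen h.isOpen hp
  have hSd := hS.differentiableAt_of_isOpen h.isOpen hp
  have hl := h.contDiffOn_slope.differentiableAt_of_isOpen h.isOpen hp
  have hlx := (contDiffOn_dx h.isOpen h.contDiffOn_slope).differentiableAt_of_isOpen h.isOpen hp
  have hu := h.contDiffOn_slopeDx.differentiableAt_of_isOpen h.isOpen hp
  have h1 : dx (dy E.slope) p = dx E.S p - 2 * dx E.R p * E.slope p - 2 * E.R p * dx E.slope p
      + dx E.Q p * E.slope p ^ 2 + 2 * E.Q p * E.slope p * dx E.slope p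
      + dx E.slope p * E.slopeDx p + E.slope p * dx E.slopeDx p := by
    rw [dx_congr h.isOpen (fun q hq => h.dy_slope hq) hp]
    simp (disch := fun_prop) only [dx_sub, dx_add, dx_mul, dx_pow, dx_const]
    ring
  have h2 : dy E.slopeDx p = dy (dx E.slope) p - dy E.P p * E.slope p ^ 2
      - 2 * E.P p * E.slope p * dy E.slope p + 2 * dy E.Q p * E.slope p
      + 2 * E.Q p * dy E.slope p - dy E.R p := by
    unfold slopeDx
    simp (disch := fun_prop) only [dy_sub, dy_add, dy_mul, dy_pow, dy_const]
    ring
  rw [h2, ← dx_dy_comm h.isOpen h.contDiffOn_slope hp, h1, h.dy_slope hp, dx_slopeDx, dx_slope]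
  unfold bAlpha0 bAlpha1 bAlpha2
  ring

/-- Compatibility of u_x and u_y. No new unknown appears, because the curvature terms amount to β₂ -
λβ₁. -/
theorem dy_slopeOmega (h : E.DegenerateOn U) (hp : p ∈ U) :
    dy E.slopeOmega p = E.slope p * dx E.slopeOmega p
      + 3 * E.slopeDx p * E.slopeOmega p := by
  have hl := h.contDiffOn_slope.differentiableAt_of_isOpen h.isOpen hp
  have hu := h.contDiffOn_slopeDx.differentiableAt_of_isOpen h.isOpen hp
  have hux := (contDiffOn_dx h.isOpen h.contDiffOn_slopeDx).differentiableAt_of_isOpen h.isOpen hp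
  have ho := h.contDiffOn_slopeOmega.differentiableAt_of_isOpen h.isOpen hp
  have a0 := (h.smooth.bAlpha0 h.isOpen).differentiableAt_of_isOpen h.isOpen hp
  have a1 := (h.smooth.bAlpha1 h.isOpen).differentiableAt_of_isOpen h.isOpen hp
  have a2 := (h.smooth.bAlpha2 h.isOpen).differentiableAt_of_isOpen h.isOpen hp
  obtain ⟨hP, hQ, hR, hS⟩ := h.smooth
  have hPd := hP.differentiableAt_of_isOpen h.isOpen hp
  have hQd := hQ.differentiableAt_of_isOpen h.isOpen hp
  have hRd := hR.differentiableAt_of_isOpen h.isOpen hp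
  have h1 : dx (dy E.slopeDx) p = dx E.slope p * E.slopeOmega p + E.slope p * dx E.slopeOmega p
      + 2 * E.slopeDx p * dx E.slopeDx p + dx E.slopeDx p * (E.Q p * E.slope p - E.R p)
      + E.slopeDx p * (dx E.Q p * E.slope p + E.Q p * dx E.slope p - dx E.R p)
      + dx E.bAlpha2 p - dx E.slope p * E.bAlpha1 p - E.slope p * dx E.bAlpha1 p := by
    rw [dx_congr h.isOpen (fun q hq => h.dy_slopeDx hq) hp]
    simp (disch := fun_prop) only [dx_sub, dx_add, dx_mul, dx_pow, dx_const]
    ring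
  have h2 : dy E.slopeOmega p = dy (dx E.slopeDx) p
      + (dy E.Q p - dy E.P p * E.slope p - E.P p * dy E.slope p) * E.slopeDx p
      + (E.Q p - E.P p * E.slope p) * dy E.slopeDx p - dy E.bAlpha1 p
      + dy E.slope p * E.bAlpha0 p + E.slope p * dy E.bAlpha0 p := by
    conv_lhs => unfold slopeOmega
    simp (disch := fun_prop) only [dy_sub, dy_add, dy_mul, dy_pow, dy_const]
    ring
  have hB := h.bBeta2_eq hp
  rw [h2, ← dx_dy_comm h.isOpen h.contDiffOn_slopeDx hp, h1, h.dy_slope hp, h.dy_slopeDx hp,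
    dx_slopeDx, dx_slope]
  unfold bBeta1 bBeta2 at hB
  unfold bAlpha0 bAlpha1 bAlpha2 at *
  linear_combination hB

end DegenerateOn


/-! ### Sharipov's fields in terms of Bagderina's quantities. -/

theorem dx_A (hU : IsOpen U) (hE : E.SmoothOn U) (hp : p ∈ U) : dx E.A p = dx E.bBeta1 p :=
  dx_congr hU (fun _ hq => A_eq_bBeta1 hU hE hq) hp

theorem dy_A (hU : IsOpen U) (hE : E.SmoothOn U) (hp : p ∈ U) : dy E.A p = dy E.bBeta1 p :=
  dy_congr hU (fun _ hq => A_eq_bBeta1 hU hE hq) hp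

theorem dx_B (hU : IsOpen U) (hE : E.SmoothOn U) (hp : p ∈ U) : dx E.B p = dx E.bBeta2 p :=
  dx_congr hU (fun _ hq => B_eq_bBeta2 hU hE hq) hp

theorem dy_B (hU : IsOpen U) (hE : E.SmoothOn U) (hp : p ∈ U) : dy E.B p = dy E.bBeta2 p :=
  dy_congr hU (fun _ hq => B_eq_bBeta2 hU hE hq) hp

theorem H_eq_neg_bGamma0 (hU : IsOpen U) (hE : E.SmoothOn U) (hp : p ∈ U) :
    E.H p = -E.bGamma0 p := by
  unfold H bGamma0 bGamma10 bGamma20 bGamma11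
  rw [dx_A hU hE hp, dy_A hU hE hp, dx_B hU hE hp, A_eq_bBeta1 hU hE hp, B_eq_bBeta2 hU hE hp]
  ring

theorem fifthRoot_eq_zero_iff {t : ℝ} : fifthRoot t = 0 ↔ t = 0 := by
  refine ⟨fun h => ?_, fun h => ?_⟩
  · rw [← fifthRoot_pow t, h]
    norm_num
  · simp [h, fifthRoot]

/-- AG + BH = -3J₀ identically, and the real fifth root vanishes only at zero. -/
theorem F_eq_zero_iff (hU : IsOpen U) (hE : E.SmoothOn U) (hp : p ∈ U) :
    E.F p = 0 ↔ E.bJ0 p = 0 := by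
  have h : (E.A p * E.G p + E.B p * E.H p) / 3 = -E.bJ0 p := by
    unfold G H bJ0 bGamma10 bGamma20 bGamma11 bGamma21
    rw [dx_A hU hE hp, dy_A hU hE hp, dx_B hU hE hp, dy_B hU hE hp, A_eq_bBeta1 hU hE hp,
      B_eq_bBeta2 hU hE hp]
    ring
  rw [F, fifthRoot_eq_zero_iff, h, neg_eq_zero]

theorem N_eq_of_ne (hU : IsOpen U) (hE : E.SmoothOn U) (hp : p ∈ U) (hA : E.bBeta1 p ≠ 0) :
    E.N p = E.bGamma0 p / (3 * E.bBeta1 p) := by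
  have hA' : E.A p ≠ 0 := by rwa [A_eq_bBeta1 hU hE hp]
  rw [N, if_pos hA', H_eq_neg_bGamma0 hU hE hp, A_eq_bBeta1 hU hE hp, neg_neg]

/-- `M` is the skew product of `α` and `γ`. -/
theorem M_eq_of_ne (hA : E.A p ≠ 0) :
    E.M p = E.A p * E.gamma2 p - E.B p * E.gamma1 p := by
  simp only [M, gamma1, gamma2, if_pos hA]
  field_simp
  ring

theorem nablaOmega_eq (X : Fin 2 → Plane → ℝ) :
    E.nablaOmega X p = X 0 p * (dx E.Omega p + E.phi1 p * E.Omega p)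
      + X 1 p * (dy E.Omega p + E.phi2 p * E.Omega p) := by
  simp [nablaOmega, nablaAlong, nabla, scalarField, pd, phi]

/-- Both ω and d are skew, so the two off-diagonal terms are equal and 5/6 doubles. -/
theorem Omega_eq : E.Omega p = 5 / 3 * (dy E.phi1 p - dx E.phi2 p) := by
  have h1 : E.phi 0 = E.phi1 := rfl
  have h2 : E.phi 1 = E.phi2 := rfl
  simp [Omega, omega, dUp, pd, Fin.sum_univ_two, h1, h2]
  ring

/-! ### Sharipov's fields through the slope, and the comparison of operators. -/

namespace DegenerateOn

theorem N_eq (h : E.DegenerateOn U) (hp : p ∈ U) :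
    E.N p = (E.bGamma20 p - E.slope p * E.bGamma10 p - 4 * E.bBeta1 p * E.slopeDx p) / 3 := by
  have hA := h.bBeta1_ne p hp
  rw [N_eq_of_ne h.isOpen h.smooth hp hA, bGamma0, h.bGamma11_eq hp, h.bBeta2_eq hp]
  field_simp
  ring

theorem phi1_eq (h : E.DegenerateOn U) (hp : p ∈ U) :
    E.phi1 p = 3 / 5 * (E.Q p - E.slope p * E.P p - dx E.bBeta1 p / E.bBeta1 p) := by
  have hA := h.bBeta1_ne p hp
  have hA' : E.A p ≠ 0 := by rwa [A_eq_bBeta1 h.isOpen h.smooth hp]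
  rw [phi1, if_pos hA', A_eq_bBeta1 h.isOpen h.smooth hp, B_eq_bBeta2 h.isOpen h.smooth hp,
    dx_A h.isOpen h.smooth hp, h.bBeta2_eq hp]
  field_simp
  ring

theorem phi2_eq (h : E.DegenerateOn U) (hp : p ∈ U) :
    E.phi2 p = 3 / 5 * (E.slope p ^ 2 * E.P p - dx E.slope p - 3 * E.slope p * E.Q p
      + 2 * E.R p - dy E.bBeta1 p / E.bBeta1 p) := by
  have hA := h.bBeta1_ne p hp
  have hA' : E.A p ≠ 0 := by rwa [A_eq_bBeta1 h.isOpen h.smooth hp]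
  rw [phi2, if_pos hA', A_eq_bBeta1 h.isOpen h.smooth hp, B_eq_bBeta2 h.isOpen h.smooth hp,
    dx_A h.isOpen h.smooth hp, dy_A h.isOpen h.smooth hp, dx_B h.isOpen h.smooth hp,
    h.dx_bBeta2 hp, h.bBeta2_eq hp]
  field_simp
  ring

theorem phi1_eq_bGamma10 (h : E.DegenerateOn U) (hp : p ∈ U) :
    E.phi1 p = -3 / 5 * (E.bGamma10 p / E.bBeta1 p) := by
  have hA := h.bBeta1_ne p hp
  rw [h.phi1_eq hp, bGamma10, h.bBeta2_eq hp]
  field_simp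
  ring

theorem phi2_eq_bGamma20 (h : E.DegenerateOn U) (hp : p ∈ U) :
    E.phi2 p = -3 / 5 * (E.slopeDx p + E.bGamma20 p / E.bBeta1 p) := by
  have hA := h.bBeta1_ne p hp
  rw [h.phi2_eq hp, bGamma20, h.bBeta2_eq hp, slopeDx]
  field_simp
  ring

/-- The terms of φ₁ and φ₂ containing derivatives of β₁ form -3/5 times its logarithmic gradient,
which has no curl. What remains involves only λ and the coefficients of the equation. -/
theorem Omega_eq_slopeOmega (h : E.DegenerateOn U) (hp : p ∈ U) :
    E.Omega p = E.slopeOmega p := by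
  have hA0 := h.bBeta1_ne p hp
  have hβ := h.smooth.bBeta1 h.isOpen
  have hA := hβ.differentiableAt_of_isOpen h.isOpen hp
  have hAx := (contDiffOn_dx h.isOpen hβ).differentiableAt_of_isOpen h.isOpen hp
  have hAy := (contDiffOn_dy h.isOpen hβ).differentiableAt_of_isOpen h.isOpen hp
  have hl := h.contDiffOn_slope.differentiableAt_of_isOpen h.isOpen hp
  have hlx := (contDiffOn_dx h.isOpen h.contDiffOn_slope).differentiableAt_of_isOpen h.isOpen hp
  obtain ⟨hP, hQ, hR, hS⟩ := h.smooth
  have hPd := hP.differentiableAt_of_isOpen h.isOpen hp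
  have hQd := hQ.differentiableAt_of_isOpen h.isOpen hp
  have hRd := hR.differentiableAt_of_isOpen h.isOpen hp
  have h1 : dy E.phi1 p = 3 / 5 * (dy E.Q p - (dy E.slope p * E.P p + E.slope p * dy E.P p)
      - (dy (dx E.bBeta1) p * E.bBeta1 p - dx E.bBeta1 p * dy E.bBeta1 p) / E.bBeta1 p ^ 2) := by
    rw [dy_congr h.isOpen (fun q hq => h.phi1_eq hq) hp]
    have hd : DifferentiableAt ℝ (fun q => dx E.bBeta1 q / E.bBeta1 q) p := by
      simpa only [div_eq_mul_inv] using hAx.fun_mul (hA.fun_inv hA0)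
    rw [dy_mul (by fun_prop) (by fun_prop), dy_sub (by fun_prop) hd, dy_div hAx hA hA0]
    simp (disch := fun_prop) only [dy_sub, dy_add, dy_mul, dy_pow, dy_const]
    ring
  have h2 : dx E.phi2 p = 3 / 5 * (2 * E.slope p * dx E.slope p * E.P p
      + E.slope p ^ 2 * dx E.P p - dx (dx E.slope) p
      - 3 * (dx E.slope p * E.Q p + E.slope p * dx E.Q p) + 2 * dx E.R p
      - (dx (dy E.bBeta1) p * E.bBeta1 p - dy E.bBeta1 p * dx E.bBeta1 p) / E.bBeta1 p ^ 2) := by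
    rw [dx_congr h.isOpen (fun q hq => h.phi2_eq hq) hp]
    have hd : DifferentiableAt ℝ (fun q => dy E.bBeta1 q / E.bBeta1 q) p := by
      simpa only [div_eq_mul_inv] using hAy.fun_mul (hA.fun_inv hA0)
    rw [dx_mul (by fun_prop) (by fun_prop), dx_sub (by fun_prop) hd, dx_div hAy hA hA0]
    simp (disch := fun_prop) only [dx_sub, dx_add, dx_mul, dx_pow, dx_const]
    ring
  have h3 : dx E.slopeDx p = dx (dx E.slope) p - dx E.P p * E.slope p ^ 2
      - 2 * E.P p * E.slope p * dx E.slope p + 2 * dx E.Q p * E.slope p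
      + 2 * E.Q p * dx E.slope p - dx E.R p := by
    unfold slopeDx
    simp (disch := fun_prop) only [dx_sub, dx_add, dx_mul, dx_pow, dx_const]
    ring
  rw [Omega_eq, h1, h2, dx_dy_comm h.isOpen hβ hp, slopeOmega, h3, h.dy_slope hp]
  unfold slopeDx bAlpha0 bAlpha1
  ring

theorem bj0_eq_Omega (h : E.DegenerateOn U) (hp : p ∈ U) : E.bj0 p = -3 * E.Omega p := by
  rw [h.bj0_eq hp, h.Omega_eq_slopeOmega hp]

/-- The term 3γ₁₀Ω/β₁² of `be1_eq` equals -5φ₁Ω/β₁, the weight-one correction completing ∂Ω/∂x to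
∇₁Ω. -/
theorem be1_eq_Omega (h : E.DegenerateOn U) (hp : p ∈ U) :
    E.be1 p = 50 - 5 * (dx E.Omega p + E.phi1 p * E.Omega p) / E.A p := by
  rw [h.be1_eq hp, dx_congr h.isOpen (fun _ hq => h.Omega_eq_slopeOmega hq) hp,
    h.Omega_eq_slopeOmega hp, h.phi1_eq_bGamma10 hp, A_eq_bBeta1 h.isOpen h.smooth hp]
  have hA := h.bBeta1_ne p hp
  field_simp
  ring

/-- The relation `∇_α Ω = (9/5) N Ω`. -/
theorem nabla_alpha_Omega (h : E.DegenerateOn U) (hp : p ∈ U) :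
    E.B p * (dx E.Omega p + E.phi1 p * E.Omega p)
      - E.A p * (dy E.Omega p + E.phi2 p * E.Omega p) = 9 / 5 * E.N p * E.Omega p := by
  rw [dx_congr h.isOpen (fun _ hq => h.Omega_eq_slopeOmega hq) hp,
    dy_congr h.isOpen (fun _ hq => h.Omega_eq_slopeOmega hq) hp, h.dy_slopeOmega hp,
    h.Omega_eq_slopeOmega hp, h.phi1_eq_bGamma10 hp, h.phi2_eq_bGamma20 hp, h.N_eq hp,
    A_eq_bBeta1 h.isOpen h.smooth hp, B_eq_bBeta2 h.isOpen h.smooth hp, h.bBeta2_eq hp]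
  have hA := h.bBeta1_ne p hp
  field_simp
  ring

/-- In the frame (α, γ), the γ₁-terms coming from ∇₁Ω in e₁ and from (9Ω/A)∇₁ cancel, by ∇_αΩ =
(9/5)NΩ. -/
theorem bD2Coeff_eq (h : E.DegenerateOn U) (hp : p ∈ U) (hM : E.M p ≠ 0) (hN : E.N p ≠ 0)
    (k : Fin 2) :
    E.bD2Coeff k p =
      (50 / E.N p - 5 * E.nablaOmega E.gammaUp p / (E.M p * E.N p)) * E.alphaUp k p
        + 5 * E.nablaOmega E.alphaUp p / (E.M p * E.N p) * E.gammaUp k p := by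
  have hβ := h.bBeta1_ne p hp
  have hAβ := A_eq_bBeta1 h.isOpen h.smooth hp
  have hBβ := B_eq_bBeta2 h.isOpen h.smooth hp
  have hA : E.A p ≠ 0 := by rwa [hAβ]
  have hMe := M_eq_of_ne hA
  have hα := h.nabla_alpha_Omega hp
  have hμ : E.bMu2 p = E.be1 p / E.N p := by
    have hN' := N_eq_of_ne h.isOpen h.smooth hp hβ
    have hΓ : E.bGamma0 p = 3 * E.bBeta1 p * E.N p := by
      rw [hN']
      field_simp
    rw [bMu2, hΓ]
    field_simp
  have a0 : E.alphaUp 0 p = E.B p := by simp [alphaUp, raise, dUp, Fin.sum_univ_two]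
  have a1 : E.alphaUp 1 p = -E.A p := by simp [alphaUp, raise, dUp, Fin.sum_univ_two]
  have g0 : E.gammaUp 0 p = E.gamma2 p := by simp [gammaUp, raise, dUp, Fin.sum_univ_two]
  have g1 : E.gammaUp 1 p = -E.gamma1 p := by simp [gammaUp, raise, dUp, Fin.sum_univ_two]
  rw [nablaOmega_eq, nablaOmega_eq, a0, a1, g0, g1]
  have e0 : E.bD2Coeff 0 p = E.be1 p / E.N p * E.B p - 3 * (-3 * E.Omega p) / E.A p := by
    rw [← h.bj0_eq_Omega hp, ← hμ, hAβ, hBβ]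
    rfl
  have e1 : E.bD2Coeff 1 p = -(E.be1 p / E.N p) * E.A p := by
    rw [← hμ, hAβ]
    rfl
  have he := h.be1_eq_Omega hp
  -- X and Y stand for ∇₁Ω and ∇₂Ω. Below, Y is eliminated by the relation for ∇_αΩ and γ₂ by the
  -- formula for M, leaving a rational identity in independent quantities.
  generalize dx E.Omega p + E.phi1 p * E.Omega p = X at *
  generalize dy E.Omega p + E.phi2 p * E.Omega p = Y at *
  have hY : Y = (E.B p * X - 9 / 5 * E.N p * E.Omega p) / E.A p := by
    field_simp
    linear_combination -5 * hα
  have hγ : E.gamma2 p = (E.M p + E.B p * E.gamma1 p) / E.A p := by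
    field_simp
    linear_combination -hMe
  match k with
  | 0 =>
    rw [e0, he, hY, hγ, a0, g0, hγ]
    field_simp
    ring
  | 1 =>
    rw [e1, he, hY, hγ, a1, g1]
    field_simp
    ring

end DegenerateOn

end Eqn

end CubicODE

end

theorem lemma6p2 (E : CubicODE.Eqn) (U : Set CubicODE.Plane) (hU : IsOpen U)
    (hE : E.SmoothOn U) :
    ((E.ShrID1 U ∧ E.BgdET2 U) ↔
      ∀ p ∈ U, E.F p = 0 ∧ E.A p ≠ 0 ∧ E.M p ≠ 0 ∧ E.Omega p ≠ 0 ∧ E.N p ≠ 0) ∧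
    (E.ShrID1 U → E.BgdET2 U →
      (∀ f : CubicODE.Plane → ℝ, DifferentiableOn ℝ f U → ∀ p ∈ U,
        E.bD2 f p =
          (50 / E.N p - 5 * E.nablaOmega E.gammaUp p / (E.M p * E.N p)) *
              E.nablaAlong E.alphaUp 0 (CubicODE.scalarField f) Fin.elim0 Fin.elim0 p +
            5 * E.nablaOmega E.alphaUp p / (E.M p * E.N p) *
              E.nablaAlong E.gammaUp 0 (CubicODE.scalarField f) Fin.elim0 Fin.elim0 p) ∧
      (∀ (r s : ℕ) (m : ℤ) (T : CubicODE.TField r s),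
        (∀ i j, DifferentiableOn ℝ (T i j) U) → ∀ i j, ∀ p ∈ U,
        E.bD2Ext m T i j p =
          (50 / E.N p - 5 * E.nablaOmega E.gammaUp p / (E.M p * E.N p)) *
              E.nablaAlong E.alphaUp m T i j p +
            5 * E.nablaOmega E.alphaUp p / (E.M p * E.N p) *
              E.nablaAlong E.gammaUp m T i j p)) := by
  -- All operators involved are combinations of the same ∇₁ and ∇₂, so it suffices to compare their
  -- two coefficients.
  have hcoeff : E.ShrID1 U → E.BgdET2 U → ∀ p ∈ U, ∀ k, E.bD2Coeff k p =
      (50 / E.N p - 5 * E.nablaOmega E.gammaUp p / (E.M p * E.N p)) * E.alphaUp k p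
        + 5 * E.nablaOmega E.alphaUp p / (E.M p * E.N p) * E.gammaUp k p := by
    intro hS hB p hp k
    have h : E.DegenerateOn U := ⟨hU, hE, fun q hq => (hB q hq).1, fun q hq => (hB q hq).2.1⟩
    refine h.bD2Coeff_eq hp (hS p hp).2.2 ?_ k
    rw [CubicODE.Eqn.N_eq_of_ne hU hE hp (h.bBeta1_ne p hp)]
    exact div_ne_zero (hB p hp).2.2.2 (mul_ne_zero three_ne_zero (h.bBeta1_ne p hp))
  refine ⟨⟨?_, ?_⟩, fun hS hB => ⟨?_, ?_⟩⟩
  · rintro ⟨hS, hB⟩ p hp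
    have h : E.DegenerateOn U := ⟨hU, hE, fun q hq => (hB q hq).1, fun q hq => (hB q hq).2.1⟩
    have hA := h.bBeta1_ne p hp
    refine ⟨(hS p hp).1, by rwa [CubicODE.Eqn.A_eq_bBeta1 hU hE hp], (hS p hp).2.2, ?_, ?_⟩
    · intro h0
      exact (hB p hp).2.2.1 (by rw [h.bj0_eq_Omega hp, h0, mul_zero])
    · rw [CubicODE.Eqn.N_eq_of_ne hU hE hp hA]
      exact div_ne_zero (hB p hp).2.2.2 (mul_ne_zero three_ne_zero hA)
  · intro hall
    have h : E.DegenerateOn U := ⟨hU, hE,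
      fun q hq => (CubicODE.Eqn.F_eq_zero_iff hU hE hq).1 (hall q hq).1,
      fun q hq => by rw [← CubicODE.Eqn.A_eq_bBeta1 hU hE hq]; exact (hall q hq).2.1⟩
    refine ⟨fun p hp => ?_, fun p hp => ?_⟩
    · obtain ⟨hF, hA, hM, -, -⟩ := hall p hp
      exact ⟨hF, Or.inl hA, hM⟩
    · obtain ⟨-, -, -, hO, hN⟩ := hall p hp
      refine ⟨h.bJ0_eq p hp, h.bBeta1_ne p hp, ?_, fun h0 => hN ?_⟩
      · rw [h.bj0_eq_Omega hp]
        exact mul_ne_zero (by norm_num) hO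
      · rw [CubicODE.Eqn.N_eq_of_ne hU hE hp (h.bBeta1_ne p hp), h0, zero_div]
  · intro f _ p hp
    have h0 := hcoeff hS hB p hp 0
    have h1 := hcoeff hS hB p hp 1
    rw [CubicODE.Eqn.bD2, h0, h1]
    -- For type (0, 0) and weight 0 every connection term vanishes and ∇ₖ is the partial derivative.
    simp [CubicODE.Eqn.nablaAlong, CubicODE.Eqn.nabla, CubicODE.scalarField, CubicODE.pd]
    ring
  · intro r s m T _ i j p hp
    have h0 := hcoeff hS hB p hp 0
    have h1 := hcoeff hS hB p hp 1
    rw [CubicODE.Eqn.bD2Ext, h0, h1, CubicODE.Eqn.nablaAlong, CubicODE.Eqn.nablaAlong]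
    ring
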